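/- **The algorithm.** For lists $\mathtt{coatoms}$, $\mathtt{ignored\_sets}$ of subsets of $V=\{1,\dots,n\}$ and a subset $\mathtt{ignored\_atoms}\subseteq V$, the recursive algorithm **FaceIterator** does nothing if $\mathtt{coatoms}$ is empty. Otherwise let $a$ be the first element of $\mathtt{coatoms}$; then it proceeds as follows. 1. If $a\cap\mathtt{ignored\_atoms}=\emptyset$, output $a$. 2. Let $\mathtt{new\_coatoms}$ be a list (without repetitions, in any order) of the inclusion-maximal elements of $\{a\cap b : b\in\mathtt{coatoms}\setminus\{a\},\ a\cap b\not\subseteq y \text{ for all } y\in\mathtt{ignored\_sets}\}$, and call FaceIterator on $(\mathtt{new\_coatoms},\mathtt{ignored\_sets},\mathtt{ignored\_atoms})$. 3. Call FaceIterator on $(\mathtt{next\_coatoms},\ \mathtt{ignored\_sets}\text{ with } a\cup\mathtt{ignored\_atoms}\text{ appended},\ \mathtt{ignored\_atoms})$, where $\mathtt{next\_coatoms}$ lists those $x\in\mathtt{coatoms}$ with $x\not\subseteq a\cup\mathtt{ignored\_atoms}$. **Corollary 3.5.** Let $P\subseteq\mathbb{R}^d$ be an unbounded polyhedron, let $L$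 be its lineality space (so $L=0$ if $P$ contains no line), and let $\overline{P}\subseteq\mathbb{R}^e$ be a polytope with marked face $\overline{F}$ that is projectively equivalent to $P/L$. This means that there is a linear isomorphism $T\colon\mathbb{R}^e\times\mathbb{R}\to(\mathbb{R}^d/L)\times\mathbb{R}$ such that, writing $T(y,1)=(z(y),t(y))$, we have $t\ge 0$ on $\overline{P}$, $\overline{F}=\{y\in\overline{P}: t(y)=0\}$ (the face at infinity, not necessarily a facet), and $y\mapsto z(y)/t(y)$ maps $\overline{P}\setminus\overline{F}$ onto $P/L$. Let $v_1,\dots,v_n$ be the distinct vertices of $\overline{P}$, and identify a face of $\overline{P}$ with the set of indices of the vertices that it contains. Provided with a list, without repetitions and in any order, of the facets (coatoms of the face lattice) of $\overline{P}$, given by their vertex sets, and with the vertex set of $\overline{F}$, the algorithm visits every nonempty face of $P$ exactly once and visits nothing else. Precisely, consider the list that consists of the set $V$ (the upper bound, visited separately) followed by the outputs of FaceIterator called with the facets not contained in $\overline{F}$ as $\mathtt{coatoms}$, $\mathtt{ignored\_sets}=[\overline{F}]$ and $\mathtt{ignored\_atoms}=\emptyset$. If each set $S$ in this list is replaced by $$\{x\in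 P : x+L = z(y)/t(y)\text{ for some } y\in\operatorname{conv}\{v_i : i\in S\}\setminus\overline{F}\},$$ then the result is a list without repetitions whose members are exactly the nonempty faces of $P$ (including $P$ itself). -/

import Mathlib

/-! ## The algorithm -/

section Algorithm

variable {α : Type*} [DecidableEq α]

/-- The inclusion-maximal members of a list of finite sets, each listed once. -/
def inclusionMaximals (l : List (Finset α)) : List (Finset α) :=
  l.dedup.filter (fun x => ∀ y ∈ l, ¬ x ⊂ y)

/-- The list `new_coatoms` computed in one call: the inclusion-maximal ones among the sets `a ∩ b`,
with `b ≠ a` in `coatoms`, that are not contained in any of the sets in `ignoredSets`. -/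
def newCoatoms (a : Finset α) (coatoms ignoredSets : List (Finset α)) : List (Finset α) :=
  inclusionMaximals
    (((coatoms.filter (fun b => b ≠ a)).map (fun b => a ∩ b)).filter
      (fun x => ∀ y ∈ ignoredSets, ¬ x ⊆ y))

theorem length_newCoatoms_lt (a : Finset α) (rest ignoredSets : List (Finset α)) :
    (newCoatoms a (a :: rest) ignoredSets).length < (a :: rest).length := by
  have h1 : (newCoatoms a (a :: rest) ignoredSets).length ≤
      ((a :: rest).filter (fun b => b ≠ a)).length := by
    refine (List.length_filter_le _ _).trans ?_
    refine (List.dedup_sublist _).length_le.trans ?_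
    refine (List.length_filter_le _ _).trans ?_
    exact (List.length_map _).le
  have h2 : ((a :: rest).filter (fun b => b ≠ a)).length ≤ rest.length := by
    simpa using List.length_filter_le (fun b => !decide (b = a)) rest
  simp only [List.length_cons]
  omega

theorem length_nextCoatoms_lt (a ignoredAtoms : Finset α) (rest : List (Finset α)) :
    ((a :: rest).filter (fun x => ¬ x ⊆ a ∪ ignoredAtoms)).length < (a :: rest).length := by
  have h : ((a :: rest).filter (fun x => ¬ x ⊆ a ∪ ignoredAtoms)).length ≤ rest.length := by
    simpa using List.length_filter_le (fun x => !decide (x ⊆ a ∪ ignoredAtoms)) rest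
  simp only [List.length_cons]
  omega

/-- The algorithm `FaceIterator`; the result is the list of its outputs, in the order in which they
occur. The subroutine `arrange` puts the newly computed list `new_coatoms` into an arbitrary
order (for instance the lexicographic one). -/
def faceIterator (arrange : (l : List (Finset α)) → {l' : List (Finset α) // l'.Perm l})
    (coatoms ignoredSets : List (Finset α)) (ignoredAtoms : Finset α) : List (Finset α) :=
  match coatoms with
  | [] => []
  | a :: rest =>
    (if a ∩ ignoredAtoms = ∅ then [a] else []) ++
      (faceIterator arrange (arrange (newCoatoms a (a :: rest) ignoredSets)).1
          ignoredSets ignoredAtoms ++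
        faceIterator arrange ((a :: rest).filter (fun x => ¬ x ⊆ a ∪ ignoredAtoms))
          (ignoredSets ++ [a ∪ ignoredAtoms]) ignoredAtoms)
termination_by coatoms.length
decreasing_by
  · rw [(arrange (newCoatoms a (a :: rest) ignoredSets)).2.length_eq]
    exact length_newCoatoms_lt a rest ignoredSets
  · exact length_nextCoatoms_lt a ignoredAtoms rest

/-- The sets visited when the algorithm is provided with the list `facets` of all coatoms of a
lattice of subsets of `α` and with a marked set `marked`: first the upper bound of the lattice, that
is the whole set `α`, and then the outputs of `FaceIterator`, called with those coatoms that are not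
contained in `marked`, with `marked` as the only ignored set, and without ignored atoms. -/
def visitedSets [Fintype α]
    (arrange : (l : List (Finset α)) → {l' : List (Finset α) // l'.Perm l})
    (facets : List (Finset α)) (marked : Finset α) : List (Finset α) :=
  Finset.univ :: faceIterator arrange (facets.filter (fun x => ¬ x ⊆ marked)) [marked] ∅

end Algorithm

/-! ## Polyhedra and polytopes -/

/-- A polyhedron in `ℝ^d`: an intersection of finitely many closed half-spaces. -/
def IsPolyhedron {d : ℕ} (P : Set (EuclideanSpace ℝ (Fin d))) : Prop :=
  ∃ (m : ℕ) (a : Fin m → EuclideanSpace ℝ (Fin d)) (b : Fin m → ℝ),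
    P = {x | ∀ i, inner ℝ (a i) x ≤ b i}

/-- A polytope in `ℝ^e`: the convex hull of finitely many points. -/
def IsPolytope {e : ℕ} (Q : Set (EuclideanSpace ℝ (Fin e))) : Prop :=
  ∃ s : Set (EuclideanSpace ℝ (Fin e)), s.Finite ∧ Q = convexHull ℝ s

/-- `G` is a face of `P`: the empty set, or the set of maximizers over `P` of a linear functional
(`P` itself is the face of the zero functional). -/
def IsFaceOf {d : ℕ} (P G : Set (EuclideanSpace ℝ (Fin d))) : Prop :=
  IsExposed ℝ P G

/-- `G` is a facet of `Q`: a coatom of the face lattice, that is a maximal proper face. -/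
def IsFacetOf {d : ℕ} (Q G : Set (EuclideanSpace ℝ (Fin d))) : Prop :=
  IsFaceOf Q G ∧ G ≠ Q ∧ ∀ H, IsFaceOf Q H → G ⊆ H → H ≠ Q → H = G

open Classical in
/-- The set of (indices of) vertices that lie in `G`. -/
noncomputable def vertexSet {e n : ℕ} (v : Fin n → EuclideanSpace ℝ (Fin e))
    (G : Set (EuclideanSpace ℝ (Fin e))) : Finset (Fin n) :=
  Finset.univ.filter (fun i => v i ∈ G)

/-- The list `facets` consists of the vertex-facet incidences of the polytope `Q` with vertices
`v 0, …, v (n - 1)`: it lists, once each and in any order, the vertex sets of the facets of `Q`. -/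
structure IsVertexFacetIncidences {e n : ℕ} (Q : Set (EuclideanSpace ℝ (Fin e)))
    (v : Fin n → EuclideanSpace ℝ (Fin e)) (facets : List (Finset (Fin n))) : Prop where
  injective : Function.Injective v
  range_eq : Set.range v = Q.extremePoints ℝ
  nodup : facets.Nodup
  mem_iff : ∀ S, S ∈ facets ↔ ∃ G, IsFacetOf Q G ∧ S = vertexSet v G

/-- The lineality space of `P`: the directions of the lines contained in `P`, for `P` a nonempty
polyhedron. It is `0` exactly when `P` contains no line. -/
def linealitySpace {d : ℕ} (P : Set (EuclideanSpace ℝ (Fin d))) :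
    Submodule ℝ (EuclideanSpace ℝ (Fin d)) where
  carrier := {w | ∀ x ∈ P, ∀ t : ℝ, x + t • w ∈ P}
  add_mem' := by
    intro u w hu hw x hx t
    have h := hw _ (hu x hx t) t
    rwa [add_assoc, ← smul_add] at h
  zero_mem' := by
    intro x hx t
    simpa using hx
  smul_mem' := by
    intro c w hw x hx t
    have h := hw x hx (t * c)
    rwa [mul_smul] at h

/-- The projective map `W ⇢ U` with homogeneous linear map `T`: in homogeneous coordinates the
point `y` of `W` is sent to `T (y, 1) = (z, t)`, the point `z / t` of `U`, when `t ≠ 0`. Points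
with `t = 0` are sent to infinity. -/
noncomputable def projMap {W U : Type*} [AddCommGroup W] [Module ℝ W] [AddCommGroup U] [Module ℝ U]
    (T : (W × ℝ) ≃ₗ[ℝ] (U × ℝ)) (y : W) : U :=
  (T (y, 1)).2⁻¹ • (T (y, 1)).1

/-- The polytope `Q` with marked face `F` is projectively equivalent to `P`, via the projective
transformation with homogeneous linear map `T`: `Q` lies (weakly) on one side of the hyperplane
that `T` sends to infinity, `F` is the part of `Q` on that hyperplane, and the rest of `Q` is
mapped onto `P`. -/
structure IsProjectivelyEquivalent {W U : Type*} [AddCommGroup W] [Module ℝ W] [AddCommGroup U]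
    [Module ℝ U] (P : Set U) (Q F : Set W) (T : (W × ℝ) ≃ₗ[ℝ] (U × ℝ)) : Prop where
  nonneg : ∀ y ∈ Q, 0 ≤ (T (y, 1)).2
  marked_eq : F = {y ∈ Q | (T (y, 1)).2 = 0}
  image_eq : projMap T '' (Q \ F) = P

/-- The subset of `P` that a set `S` of vertices of `Q` stands for: the part outside `F` of the
convex hull of these vertices, transported to `P`. -/
noncomputable def visitedFace {d e n : ℕ} (P : Set (EuclideanSpace ℝ (Fin d)))
    (F : Set (EuclideanSpace ℝ (Fin e))) (v : Fin n → EuclideanSpace ℝ (Fin e))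
    (T : (EuclideanSpace ℝ (Fin e) × ℝ) ≃ₗ[ℝ]
      ((EuclideanSpace ℝ (Fin d) ⧸ linealitySpace P) × ℝ))
    (S : Finset (Fin n)) : Set (EuclideanSpace ℝ (Fin d)) :=
  {x ∈ P | (linealitySpace P).mkQ x ∈ projMap T '' (convexHull ℝ (v '' (S : Set (Fin n))) \ F)}

/-! A face is the zero set of a nonnegative affine function, and in homogeneous coordinates such
functions pull back and forth along `T`. Off `F` this only rescales by the positive factor `t`, so
nonempty faces of `P` correspond to the faces of `Q` not contained in `F`. Injectivity holds because
a face not contained in `F` is determined by its part outside `F` (`exists_visitedFace_eq`,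
`subset_of_visitedFace_subset`).

It remains to see that the algorithm lists the vertex sets of exactly these faces, which is pure
combinatorics (`faceIterator_nodup_and_mem_iff`). Below `X`, every remaining set either lies in the
chosen coatom `a` or does not. The two recursive calls separate these cases, provided that
`newCoatoms` really computes the relevant coatoms of `a`. That needs intersections and local
branching (`mem_newCoatoms_iff`); vertex sets of faces are locally branched by a ratio test
(`isLocallyBranched_isFaceSet`). -/

/-! ### Correctness of the algorithm on locally branched families -/

section Combinatorics

variable {α : Type*}

/-- The family `𝓕` is locally branched: between a member `c` and a member `X` that is not a cover
of `c` there are incomparable members. -/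
def IsLocallyBranched (𝓕 : Finset α → Prop) : Prop :=
  ∀ c a X, 𝓕 c → 𝓕 a → 𝓕 X → c ⊂ a → a ⊂ X → ∃ b, 𝓕 b ∧ c ⊆ b ∧ b ⊂ X ∧ ¬ b ⊆ a

/-- `a` is a coatom of the interval below `X` in the family `𝓕`. -/
def IsCoatomBelow (𝓕 : Finset α → Prop) (X a : Finset α) : Prop :=
  Maximal (fun b => 𝓕 b ∧ b ⊂ X) a

theorem exists_isCoatomBelow_of_ssubset {𝓕 : Finset α → Prop} {X b : Finset α} (hb : 𝓕 b)
    (hbX : b ⊂ X) : ∃ a, b ⊆ a ∧ IsCoatomBelow 𝓕 X a := by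
  have hfin : {b | 𝓕 b ∧ b ⊂ X}.Finite :=
    X.powerset.finite_toSet.subset fun b hb => by simpa using hb.2.subset
  obtain ⟨a, ha, hmax⟩ := hfin.exists_le_maximal (a := b) ⟨hb, hbX⟩
  exact ⟨a, ha, hmax⟩

theorem IsCoatomBelow.eq_of_subset {𝓕 : Finset α → Prop} {X a b : Finset α}
    (ha : IsCoatomBelow 𝓕 X a) (hb : 𝓕 b) (hbX : b ⊂ X) (hab : a ⊆ b) : a = b :=
  Maximal.eq_of_le ha ⟨hb, hbX⟩ hab

theorem mem_inclusionMaximals [DecidableEq α] {l : List (Finset α)} {x : Finset α} :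
    x ∈ inclusionMaximals l ↔ x ∈ l ∧ ∀ y ∈ l, ¬ x ⊂ y := by
  simp [inclusionMaximals]

theorem nodup_newCoatoms [DecidableEq α] (a : Finset α) (l ign : List (Finset α)) :
    (newCoatoms a l ign).Nodup :=
  (List.nodup_dedup _).filter _

/-- Branching below `X` yields a member containing `c` but not inside `a`; enlarged to a coatom `b'`
of `X`, it meets `a` exactly in `c`. No ignored set contains `b'`, since none contains the smaller
`c`, so `b'` is still in the list. Conversely, a maximal intersection lies below a coatom of `a`,
which is itself such an intersection. -/
theorem mem_newCoatoms_iff [DecidableEq α] {𝓕 : Finset α → Prop}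
    (hinter : ∀ a b, 𝓕 a → 𝓕 b → 𝓕 (a ∩ b)) (hbranch : IsLocallyBranched 𝓕)
    {X a : Finset α} {l ign : List (Finset α)} (hX : 𝓕 X) (hal : a ∈ l)
    (hl : ∀ b, b ∈ l ↔ IsCoatomBelow 𝓕 X b ∧ ∀ y ∈ ign, ¬ b ⊆ y) (c : Finset α) :
    c ∈ newCoatoms a l ign ↔ IsCoatomBelow 𝓕 a c ∧ ∀ y ∈ ign, ¬ c ⊆ y := by
  have ha := ((hl a).1 hal).1
  have hmem : ∀ x, x ∈ ((l.filter (fun b => b ≠ a)).map (fun b => a ∩ b)).filter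
      (fun x => ∀ y ∈ ign, ¬ x ⊆ y) ↔
      (∃ b, b ∈ l ∧ b ≠ a ∧ a ∩ b = x) ∧ ∀ y ∈ ign, ¬ x ⊆ y := by
    intro x
    simp [and_assoc]
  have hinterFace : ∀ b, b ∈ l → b ≠ a → 𝓕 (a ∩ b) ∧ a ∩ b ⊂ a := by
    intro b hb hne
    have hb' := ((hl b).1 hb).1
    refine ⟨hinter _ _ ha.1.1 hb'.1.1, Finset.inter_subset_left.ssubset_of_ne fun h => hne ?_⟩
    exact (ha.eq_of_subset hb'.1.1 hb'.1.2 (Finset.inter_eq_left.1 h)).symm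
  have hcover : ∀ c, IsCoatomBelow 𝓕 a c → (∀ y ∈ ign, ¬ c ⊆ y) →
      ∃ b, b ∈ l ∧ b ≠ a ∧ a ∩ b = c := by
    intro c hc hign
    obtain ⟨b, hb, hcb, hbX, hba⟩ := hbranch c a X hc.1.1 ha.1.1 hX hc.1.2 ha.1.2
    obtain ⟨b', hbb', hb'⟩ := exists_isCoatomBelow_of_ssubset hb hbX
    have hne : b' ≠ a := fun h => hba (h ▸ hbb')
    have hb'l : b' ∈ l := (hl b').2 ⟨hb', fun y hy h => hign y hy ((hcb.trans hbb').trans h)⟩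
    obtain ⟨h1, h2⟩ := hinterFace b' hb'l hne
    exact ⟨b', hb'l, hne,
      (hc.eq_of_subset h1 h2 (Finset.subset_inter hc.1.2.subset (hcb.trans hbb'))).symm⟩
  rw [newCoatoms, mem_inclusionMaximals]
  simp only [hmem]
  constructor
  · rintro ⟨⟨⟨b, hb, hne, rfl⟩, hign⟩, hmax⟩
    obtain ⟨h1, h2⟩ := hinterFace b hb hne
    obtain ⟨c, hc, hcoat⟩ := exists_isCoatomBelow_of_ssubset h1 h2
    have hcign : ∀ y ∈ ign, ¬ c ⊆ y := fun y hy h => hign y hy (hc.trans h)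
    have heq : a ∩ b = c := by
      by_contra hne'
      exact hmax c ⟨hcover c hcoat hcign, hcign⟩ (hc.ssubset_of_ne hne')
    exact ⟨heq ▸ hcoat, hign⟩
  · rintro ⟨hc, hign⟩
    refine ⟨⟨hcover c hc hign, hign⟩, ?_⟩
    rintro y ⟨⟨b, hb, hne, rfl⟩, -⟩ hlt
    obtain ⟨h1, h2⟩ := hinterFace b hb hne
    exact hlt.ne (hc.eq_of_subset h1 h2 hlt.subset)

/-- In a locally branched family of sets that is closed under intersections, `FaceIterator` lists
the proper subsets of an upper bound that are not contained in an ignored set, once each. -/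
theorem faceIterator_nodup_and_mem_iff [DecidableEq α] {𝓕 : Finset α → Prop}
    (hinter : ∀ a b, 𝓕 a → 𝓕 b → 𝓕 (a ∩ b)) (hbranch : IsLocallyBranched 𝓕)
    (arrange : (l : List (Finset α)) → {l' : List (Finset α) // l'.Perm l})
    (X : Finset α) (l ign : List (Finset α)) (hX : 𝓕 X) (hnd : l.Nodup)
    (hl : ∀ b, b ∈ l ↔ IsCoatomBelow 𝓕 X b ∧ ∀ y ∈ ign, ¬ b ⊆ y) :
    (faceIterator arrange l ign ∅).Nodup ∧
      ∀ S, S ∈ faceIterator arrange l ign ∅ ↔ 𝓕 S ∧ S ⊂ X ∧ ∀ y ∈ ign, ¬ S ⊆ y := by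
  induction hN : l.length using Nat.strong_induction_on generalizing X l ign with
  | _ N ih =>
  subst hN
  cases l with
  | nil =>
    rw [faceIterator]
    refine ⟨List.nodup_nil, fun S => ⟨fun h => by simp at h, ?_⟩⟩
    rintro ⟨hS, hSX, hign⟩
    obtain ⟨a, hSa, ha⟩ := exists_isCoatomBelow_of_ssubset hS hSX
    exact absurd ((hl a).2 ⟨ha, fun y hy h => hign y hy (hSa.trans h)⟩) (by simp)
  | cons a rest =>
    have hal : a ∈ a :: rest := List.mem_cons_self
    obtain ⟨ha, haign⟩ := (hl a).1 hal
    -- The first call descends to the upper bound `a` with the same ignored sets; the second, `h2`,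
    -- keeps `X` and ignores `a` too.
    have h1 := ih _ (by
        rw [(arrange (newCoatoms a (a :: rest) ign)).2.length_eq]
        exact length_newCoatoms_lt a rest ign) a
      (arrange (newCoatoms a (a :: rest) ign)).1 ign ha.1.1
      ((arrange _).2.nodup_iff.2 (nodup_newCoatoms _ _ _))
      (fun b => by
        rw [(arrange _).2.mem_iff]
        exact mem_newCoatoms_iff hinter hbranch hX hal hl b) rfl
    have h2 := ih _ (length_nextCoatoms_lt a ∅ rest) X
      ((a :: rest).filter (fun x => ¬ x ⊆ a ∪ ∅)) (ign ++ [a ∪ ∅]) hX (hnd.filter _)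
      (fun b => by
        rw [List.mem_filter, hl]
        simp only [Finset.union_empty, List.mem_append, List.mem_singleton, decide_eq_true_eq,
          or_imp, forall_and, forall_eq, and_assoc]) rfl
    rw [faceIterator, if_pos (Finset.inter_empty a)]
    obtain ⟨n1, m1⟩ := h1
    obtain ⟨n2, m2⟩ := h2
    simp only [Finset.union_empty, List.mem_append, List.mem_singleton, or_imp, forall_and,
      forall_eq] at n2 m2 ⊢
    refine ⟨?_, fun S => ?_⟩
    · rw [List.singleton_append, List.nodup_cons, List.mem_append, m1, m2]
      refine ⟨?_, n1.append n2 ?_⟩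
      · rintro (⟨-, h, -⟩ | ⟨-, -, -, h⟩)
        · exact h.ne rfl
        · exact h subset_rfl
      · intro S hS1 hS2
        exact ((m2 S).1 hS2).2.2.2 ((m1 S).1 hS1).2.1.subset
    · rw [m1, m2]
      constructor
      · rintro (rfl | ⟨hS, hSa, hign⟩ | ⟨hS, hSX, hign, -⟩)
        · exact ⟨ha.1.1, ha.1.2, haign⟩
        · exact ⟨hS, hSa.trans ha.1.2, hign⟩
        · exact ⟨hS, hSX, hign⟩
      · rintro ⟨hS, hSX, hign⟩
        by_cases hSa : S ⊆ a
        · rcases hSa.eq_or_ssubset with h | h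
          · exact Or.inl h
          · exact Or.inr (Or.inl ⟨hS, h, hign⟩)
        · exact Or.inr (Or.inr ⟨hS, hSX, hign, hSa⟩)

end Combinatorics

/-! ### Vertex sets of faces via homogeneous functionals -/

section FaceSets

variable {E ι : Type*} [AddCommGroup E] [Module ℝ E]

/-- `S` indexes the points among `v i` on which some affine function that is nonnegative on all of
them vanishes; the affine function is given in homogeneous coordinates. -/
def IsFaceSet (v : ι → E) (S : Finset ι) : Prop :=
  ∃ h : (E × ℝ) →ₗ[ℝ] ℝ, (∀ i, 0 ≤ h (v i, 1)) ∧ ∀ i, i ∈ S ↔ h (v i, 1) = 0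

theorem isFaceSet_univ [Fintype ι] (v : ι → E) : IsFaceSet v Finset.univ :=
  ⟨0, by simp⟩

theorem IsFaceSet.inter [DecidableEq ι] {v : ι → E} {S S' : Finset ι} (hS : IsFaceSet v S)
    (hS' : IsFaceSet v S') : IsFaceSet v (S ∩ S') := by
  obtain ⟨h, h0, hz⟩ := hS
  obtain ⟨h', h0', hz'⟩ := hS'
  refine ⟨h + h', fun i => add_nonneg (h0 i) (h0' i), fun i => ?_⟩
  rw [Finset.mem_inter, hz, hz', LinearMap.add_apply, add_eq_zero_iff_of_nonneg (h0 i) (h0' i)]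

theorem exists_pos_forall_add_mul_pos [Finite ι] (f g : ι → ℝ) :
    ∃ M : ℝ, ∀ i, 0 < f i → 0 < g i + M * f i := by
  cases nonempty_fintype ι
  -- All summands are nonnegative, so the sum dominates each; those with `f i = 0` are zero by
  -- convention.
  refine ⟨∑ i, (|g i| + 1) / |f i|, fun i hi => ?_⟩
  have h1 : (|g i| + 1) / |f i| ≤ ∑ i, (|g i| + 1) / |f i| :=
    Finset.single_le_sum (f := fun i => (|g i| + 1) / |f i|) (fun j _ => by positivity)
      (Finset.mem_univ i)
  have h2 := mul_le_mul_of_nonneg_right h1 hi.le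
  rw [abs_of_pos hi, div_mul_cancel₀ _ hi.ne'] at h2
  have := neg_abs_le (g i)
  linarith

/-- Tilt `fc` by subtracting the largest multiple of `fa` that keeps it nonnegative on `X`. The
result `g` acquires a zero `w` in `X` outside `a`, still vanishes on `c`, and stays positive on `a \
c`. A large multiple of `fX` then makes it positive outside `X` without changing it on `X`. -/
theorem isLocallyBranched_isFaceSet [Finite ι] [DecidableEq ι] (v : ι → E) :
    IsLocallyBranched (IsFaceSet v) := by
  rintro c a X ⟨fc, hc0, hc⟩ ⟨fa, ha0, ha⟩ ⟨fX, hX0, hX⟩ hca haX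
  have hapos : ∀ i, i ∉ a → 0 < fa (v i, 1) := fun i hi =>
    (ha0 i).lt_of_ne fun h => hi ((ha i).2 h.symm)
  obtain ⟨w, hw, hmin⟩ := (X \ a).exists_min_image (fun i => fc (v i, 1) / fa (v i, 1))
    (Finset.sdiff_nonempty.2 haX.not_subset)
  obtain ⟨hwX, hwa⟩ := Finset.mem_sdiff.1 hw
  set r := fc (v w, 1) / fa (v w, 1) with hr
  let g := fc - r • fa
  have hg : ∀ i, g (v i, 1) = fc (v i, 1) - r * fa (v i, 1) := fun i => rfl
  have hgX : ∀ i ∈ X, 0 ≤ g (v i, 1) := by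
    intro i hi
    rw [hg]
    by_cases hia : i ∈ a
    · simpa [(ha i).1 hia] using hc0 i
    · have := (le_div_iff₀ (hapos i hia)).1 (hmin i (Finset.mem_sdiff.2 ⟨hi, hia⟩))
      linarith
  obtain ⟨M, hM⟩ := exists_pos_forall_add_mul_pos (fun i => fX (v i, 1)) (fun i => g (v i, 1))
  have hk : ∀ i, (g + M • fX) (v i, 1) = g (v i, 1) + M * fX (v i, 1) := fun i => rfl
  have hkX : ∀ i ∈ X, (g + M • fX) (v i, 1) = g (v i, 1) := fun i hi => by
    simp [(hX i).1 hi]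
  have hkpos : ∀ i, i ∉ X → 0 < (g + M • fX) (v i, 1) := fun i hi =>
    hM i ((hX0 i).lt_of_ne fun h => hi ((hX i).2 h.symm))
  obtain ⟨j, hja, hjc⟩ := Finset.exists_of_ssubset hca
  have hmem : ∀ i, i ∈ X.filter (fun i => g (v i, 1) = 0) ↔ (g + M • fX) (v i, 1) = 0 := by
    intro i
    rw [Finset.mem_filter]
    by_cases hi : i ∈ X
    · simp [hi, (hX i).1 hi]
    · simp only [hi, false_and, false_iff]
      exact (hkpos i hi).ne'
  refine ⟨X.filter (fun i => g (v i, 1) = 0), ⟨g + M • fX, fun i => ?_, hmem⟩, ?_, ?_, ?_⟩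
  · by_cases hi : i ∈ X
    · rw [hkX i hi]
      exact hgX i hi
    · exact (hkpos i hi).le
  · intro i hi
    refine Finset.mem_filter.2 ⟨haX.subset (hca.subset hi), ?_⟩
    rw [hg, (hc i).1 hi, (ha i).1 (hca.subset hi)]
    ring
  · refine (Finset.filter_subset _ _).ssubset_of_ne fun h => hjc ((hc j).2 ?_)
    have hj : j ∈ X.filter (fun i => g (v i, 1) = 0) := h.symm ▸ haX.subset hja
    have := (Finset.mem_filter.1 hj).2
    rw [hg, (ha j).1 hja] at this
    linarith
  · intro h
    refine hwa (h (Finset.mem_filter.2 ⟨hwX, ?_⟩))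
    rw [hg, hr, div_mul_cancel₀ _ (hapos w hwa).ne', sub_self]

theorem homogeneous_apply (h : (E × ℝ) →ₗ[ℝ] ℝ) (x : E) (t : ℝ) :
    h (x, t) = h (x, 0) + t * h (0, 1) := by
  rw [← smul_eq_mul, ← map_smul, ← map_add]
  simp

theorem homogeneous_combo (h : (E × ℝ) →ₗ[ℝ] ℝ) (x y : E) {a b : ℝ} (hab : a + b = 1) :
    h (a • x + b • y, 1) = a * h (x, 1) + b * h (y, 1) := by
  rw [← smul_eq_mul, ← smul_eq_mul, ← map_smul, ← map_smul, ← map_add]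
  simp [hab]

theorem nonneg_on_convexHull {v : ι → E} {h : (E × ℝ) →ₗ[ℝ] ℝ} (h0 : ∀ i, 0 ≤ h (v i, 1)) {y : E}
    (hy : y ∈ convexHull ℝ (Set.range v)) : 0 ≤ h (y, 1) := by
  have hconv : Convex ℝ {y : E | 0 ≤ h (y, 1)} := by
    intro x hx y hy a b ha hb hab
    change 0 ≤ h (a • x + b • y, 1)
    rw [homogeneous_combo h x y hab]
    exact add_nonneg (mul_nonneg ha hx) (mul_nonneg hb hy)
  exact convexHull_min (s := Set.range v) (Set.range_subset_iff.2 h0) hconv hy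

/-- The zero set on a convex hull of an affine function that is nonnegative on the given points is
the convex hull of its zeros among these points. -/
theorem mem_convexHull_image_iff [Finite ι] {v : ι → E} {S : Finset ι} {h : (E × ℝ) →ₗ[ℝ] ℝ}
    (h0 : ∀ i, 0 ≤ h (v i, 1)) (hS : ∀ i, i ∈ S ↔ h (v i, 1) = 0) {y : E} :
    y ∈ convexHull ℝ (v '' (S : Set ι)) ↔ y ∈ convexHull ℝ (Set.range v) ∧ h (y, 1) = 0 := by
  constructor
  · intro hy
    refine ⟨convexHull_mono (Set.image_subset_range _ _) hy, ?_⟩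
    have hconv : Convex ℝ {y : E | h (y, 1) = 0} := by
      intro x hx y hy a b ha hb hab
      change h (x, 1) = 0 at hx
      change h (y, 1) = 0 at hy
      change h (a • x + b • y, 1) = 0
      rw [homogeneous_combo h x y hab, hx, hy]
      ring
    refine convexHull_min ?_ hconv hy
    rintro _ ⟨i, hi, rfl⟩
    exact (hS i).1 hi
  · rintro ⟨hy, hz⟩
    -- `C` is convex because a vanishing combination of nonnegative values vanishes at each endpoint
    -- of positive weight.
    let C : Set E := {y | 0 ≤ h (y, 1) ∧ (h (y, 1) = 0 → y ∈ convexHull ℝ (v '' (S : Set ι)))}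
    have hconv : Convex ℝ C := by
      rintro x ⟨hx, hx'⟩ y ⟨hy, hy'⟩ a b ha hb hab
      have hax := mul_nonneg ha hx
      have hby := mul_nonneg hb hy
      refine ⟨by rw [homogeneous_combo h x y hab]; positivity, fun hz => ?_⟩
      rw [homogeneous_combo h x y hab, add_eq_zero_iff_of_nonneg hax hby] at hz
      rcases ha.eq_or_lt with rfl | ha'
      · obtain rfl : b = 1 := by linarith
        simpa using hy' (by simpa using hz.2)
      rcases hb.eq_or_lt with rfl | hb'
      · obtain rfl : a = 1 := by linarith
        simpa using hx' (by simpa using hz.1)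
      exact convex_convexHull ℝ _ (hx' ((mul_eq_zero.1 hz.1).resolve_left ha'.ne'))
        (hy' ((mul_eq_zero.1 hz.2).resolve_left hb'.ne')) ha hb hab
    have hsub : Set.range v ⊆ C := by
      rintro _ ⟨i, rfl⟩
      exact ⟨h0 i, fun hi => subset_convexHull ℝ _ ⟨i, (hS i).2 hi, rfl⟩⟩
    exact (convexHull_min hsub hconv hy).2 hz

end FaceSets

/-! ### Exposed faces as zero sets of affine functions -/

section Exposed

variable {E : Type*} [AddCommGroup E] [Module ℝ E] [TopologicalSpace E]

theorem isExposed_setOf_homogeneous_eq_zero [IsTopologicalAddGroup E] [ContinuousSMul ℝ E]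
    [T2Space E] [FiniteDimensional ℝ E] {A : Set E} (h : (E × ℝ) →ₗ[ℝ] ℝ)
    (h0 : ∀ x ∈ A, 0 ≤ h (x, 1)) : IsExposed ℝ A {x ∈ A | h (x, 1) = 0} := by
  rintro ⟨x₀, hx₀, hz⟩
  refine ⟨-(h ∘ₗ LinearMap.inl ℝ E ℝ).toContinuousLinearMap, ?_⟩
  ext x
  refine and_congr_right fun hx => ?_
  change h (x, 1) = 0 ↔ ∀ y ∈ A, -h (y, 0) ≤ -h (x, 0)
  rw [homogeneous_apply] at hz ⊢
  constructor
  · intro hxz y hy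
    have := h0 y hy
    rw [homogeneous_apply] at this
    linarith
  · intro hmax
    have h1 := hmax x₀ hx₀
    have h2 := h0 x hx
    rw [homogeneous_apply] at h2
    linarith

theorem IsExposed.exists_homogeneous {A B : Set E} (hB : IsExposed ℝ A B) :
    ∃ h : (E × ℝ) →ₗ[ℝ] ℝ, (∀ x ∈ A, 0 ≤ h (x, 1)) ∧ B = {x ∈ A | h (x, 1) = 0} := by
  rcases B.eq_empty_or_nonempty with rfl | hne
  -- The empty face is the zero set of the constant function 1.
  · refine ⟨LinearMap.snd ℝ E ℝ, fun x _ => by simp, ?_⟩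
    ext x
    simp
  · obtain ⟨l, rfl⟩ := hB hne
    obtain ⟨x₀, hx₀, hmax⟩ := hne
    refine ⟨l x₀ • LinearMap.snd ℝ E ℝ - l.toLinearMap ∘ₗ LinearMap.fst ℝ E ℝ, ?_, ?_⟩
    · intro x hx
      simpa using hmax x hx
    · ext x
      refine and_congr_right fun hx => ?_
      have := hmax x hx
      simp only [LinearMap.sub_apply, LinearMap.smul_apply, LinearMap.snd_apply,
        LinearMap.comp_apply, LinearMap.fst_apply, ContinuousLinearMap.coe_coe, smul_eq_mul,
        mul_one, sub_eq_zero]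
      exact ⟨fun h => le_antisymm (h x₀ hx₀) this, fun h y hy => h ▸ hmax y hy⟩

end Exposed

/-! ### Faces of a polytope and their vertex sets -/

section PolytopeFaces

variable {e n : ℕ} {v : Fin n → EuclideanSpace ℝ (Fin e)}

theorem mem_vertexSet {G : Set (EuclideanSpace ℝ (Fin e))} {i : Fin n} :
    i ∈ vertexSet v G ↔ v i ∈ G := by
  simp [vertexSet]

theorem mem_range_convexHull (v : Fin n → EuclideanSpace ℝ (Fin e)) (i : Fin n) :
    v i ∈ convexHull ℝ (Set.range v) :=
  subset_convexHull ℝ _ (Set.mem_range_self i)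

/-- Krein–Milman; the closure is superfluous for finitely many vertices. -/
theorem IsPolytope.eq_convexHull_range {Q : Set (EuclideanSpace ℝ (Fin e))} (hQ : IsPolytope Q)
    (hv : Set.range v = Q.extremePoints ℝ) : Q = convexHull ℝ (Set.range v) := by
  obtain ⟨s, hs, rfl⟩ := hQ
  rw [← (Set.finite_range v).isClosed_convexHull ℝ |>.closure_eq, hv]
  exact (closure_convexHull_extremePoints (hs.isCompact_convexHull ℝ)
    (convex_convexHull ℝ s)).symm

theorem IsFaceSet.isFaceOf {S : Finset (Fin n)} (hS : IsFaceSet v S) :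
    IsFaceOf (convexHull ℝ (Set.range v)) (convexHull ℝ (v '' (S : Set (Fin n)))) := by
  obtain ⟨h, h0, hz⟩ := hS
  have : convexHull ℝ (v '' (S : Set (Fin n))) =
      {y ∈ convexHull ℝ (Set.range v) | h (y, 1) = 0} :=
    Set.ext fun y => mem_convexHull_image_iff h0 hz
  rw [this]
  exact isExposed_setOf_homogeneous_eq_zero h fun y hy => nonneg_on_convexHull h0 hy

theorem IsFaceSet.vertexSet_convexHull {S : Finset (Fin n)} (hS : IsFaceSet v S) :
    vertexSet v (convexHull ℝ (v '' (S : Set (Fin n)))) = S := by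
  obtain ⟨h, h0, hz⟩ := hS
  ext i
  rw [mem_vertexSet, mem_convexHull_image_iff h0 hz, hz]
  exact and_iff_right (mem_range_convexHull v i)

theorem IsFaceOf.isFaceSet_vertexSet {G : Set (EuclideanSpace ℝ (Fin e))}
    (hG : IsFaceOf (convexHull ℝ (Set.range v)) G) :
    IsFaceSet v (vertexSet v G) ∧ convexHull ℝ (v '' (vertexSet v G : Set (Fin n))) = G := by
  obtain ⟨h, h0, rfl⟩ := IsExposed.exists_homogeneous hG
  have h0' : ∀ i, 0 ≤ h (v i, 1) := fun i => h0 _ (mem_range_convexHull v i)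
  have hz : ∀ i, i ∈ vertexSet v {x ∈ convexHull ℝ (Set.range v) | h (x, 1) = 0} ↔
      h (v i, 1) = 0 := fun i => by
    rw [mem_vertexSet]
    exact and_iff_right (mem_range_convexHull v i)
  exact ⟨⟨h, h0', hz⟩, Set.ext fun y => mem_convexHull_image_iff h0' hz⟩

theorem vertexSet_mono {G H : Set (EuclideanSpace ℝ (Fin e))} (h : G ⊆ H) :
    vertexSet v G ⊆ vertexSet v H := fun _ hi =>
  mem_vertexSet.2 (h (mem_vertexSet.1 hi))

/-- Convex hull and `vertexSet` are mutually inverse monotone maps between face sets and faces, so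
maximality transfers. -/
theorem IsVertexFacetIncidences.mem_iff_isCoatomBelow {Q : Set (EuclideanSpace ℝ (Fin e))}
    {facets : List (Finset (Fin n))} (hinc : IsVertexFacetIncidences Q v facets)
    (hQ : Q = convexHull ℝ (Set.range v)) (S : Finset (Fin n)) :
    S ∈ facets ↔ IsCoatomBelow (IsFaceSet v) Finset.univ S := by
  subst hQ
  have huniv : convexHull ℝ (v '' ((Finset.univ : Finset (Fin n)) : Set (Fin n))) =
      convexHull ℝ (Set.range v) := by simp
  have hmono : ∀ {S S' : Finset (Fin n)}, S ⊆ S' →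
      convexHull ℝ (v '' (S : Set (Fin n))) ⊆ convexHull ℝ (v '' (S' : Set (Fin n))) :=
    fun h => convexHull_mono (Set.image_mono (Finset.coe_subset.2 h))
  have hne : ∀ {S : Finset (Fin n)}, IsFaceSet v S → S ≠ Finset.univ →
      convexHull ℝ (v '' (S : Set (Fin n))) ≠ convexHull ℝ (Set.range v) := by
    intro S hS hSu h
    apply hSu
    rw [← hS.vertexSet_convexHull, h, ← huniv, (isFaceSet_univ v).vertexSet_convexHull]
  rw [hinc.mem_iff]
  constructor
  · rintro ⟨G, ⟨hG, hGne, hGmax⟩, rfl⟩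
    obtain ⟨h1, h2⟩ := hG.isFaceSet_vertexSet
    refine ⟨⟨h1, Finset.ssubset_univ_iff.2 fun h => hGne ?_⟩, ?_⟩
    · rw [← h2, h, huniv]
    · rintro b ⟨hb, hbu⟩ hle
      have hsub : G ⊆ convexHull ℝ (v '' (b : Set (Fin n))) := h2 ▸ hmono hle
      have := hGmax _ hb.isFaceOf hsub (hne hb hbu.ne)
      rw [← this, hb.vertexSet_convexHull]
  · intro hS
    refine ⟨_, ⟨hS.1.1.isFaceOf, hne hS.1.1 hS.1.2.ne, ?_⟩, hS.1.1.vertexSet_convexHull.symm⟩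
    intro H hH hsub hHne
    obtain ⟨h1, h2⟩ := hH.isFaceSet_vertexSet
    have hle : S ⊆ vertexSet v H := hS.1.1.vertexSet_convexHull ▸ vertexSet_mono hsub
    rw [hS.eq_of_subset h1 (Finset.ssubset_univ_iff.2 fun h => hHne ?_) hle, h2]
    rw [← h2, h, huniv]

end PolytopeFaces

/-! ### Pulling back affine functions along a projective map -/

section Projective

variable {W U : Type*} [AddCommGroup W] [Module ℝ W] [AddCommGroup U] [Module ℝ U]

theorem smul_projMap_one (T : (W × ℝ) ≃ₗ[ℝ] (U × ℝ)) {y : W} (hy : (T (y, 1)).2 ≠ 0) :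
    (T (y, 1)).2 • ((projMap T y, 1) : U × ℝ) = T (y, 1) := by
  ext
  · simp [projMap, smul_smul, hy]
  · simp

theorem homogeneous_projMap (T : (W × ℝ) ≃ₗ[ℝ] (U × ℝ)) (f : (U × ℝ) →ₗ[ℝ] ℝ) {y : W}
    (hy : (T (y, 1)).2 ≠ 0) : f (T (y, 1)) = (T (y, 1)).2 * f (projMap T y, 1) := by
  rw [← smul_eq_mul, ← map_smul, smul_projMap_one T hy]

theorem IsProjectivelyEquivalent.pos {P : Set U} {Q F : Set W} {T : (W × ℝ) ≃ₗ[ℝ] (U × ℝ)}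
    (hT : IsProjectivelyEquivalent P Q F T) {y : W} (hy : y ∈ Q \ F) : 0 < (T (y, 1)).2 :=
  (hT.nonneg y hy.1).lt_of_ne fun h => hy.2 (by rw [hT.marked_eq]; exact ⟨hy.1, h.symm⟩)

/-- An affine function on `P` that is nonnegative pulls back to one that is nonnegative on the
whole of `Q`, including the marked face. -/
theorem IsProjectivelyEquivalent.nonneg_comp {P : Set U} {Q F : Set W}
    {T : (W × ℝ) ≃ₗ[ℝ] (U × ℝ)} (hT : IsProjectivelyEquivalent P Q F T) (hQ : Convex ℝ Q)
    (hne : (Q \ F).Nonempty) {f : (U × ℝ) →ₗ[ℝ] ℝ} (hf : ∀ x ∈ P, 0 ≤ f (x, 1)) {y : W}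
    (hy : y ∈ Q) : 0 ≤ f (T (y, 1)) := by
  have key : ∀ y ∈ Q, 0 < (T (y, 1)).2 → 0 ≤ f (T (y, 1)) := by
    intro y hy hpos
    rw [homogeneous_projMap T f hpos.ne']
    refine mul_nonneg hpos.le (hf _ ?_)
    rw [← hT.image_eq]
    refine ⟨y, ⟨hy, fun hyF => ?_⟩, rfl⟩
    rw [hT.marked_eq] at hyF
    exact hpos.ne' hyF.2
  obtain ⟨y₀, hy₀⟩ := hne
  by_contra! hneg
  have h0 := key y₀ hy₀.1 (hT.pos hy₀)
  set p := f (T (y₀, 1)) with hp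
  set q := f (T (y, 1)) with hq
  have hd : 0 < 2 * p - q := by linarith
  -- The weight of `y₀` is positive, which moves the point off the hyperplane at infinity, yet small
  -- enough that `a * p + (1 - a) * q` stays negative, contradicting `key`.
  set a := -q / (2 * p - q) / 2 with hadef
  have ha : 0 < a := half_pos (div_pos (neg_pos.2 hneg) hd)
  have had : a * (2 * (2 * p - q)) = -q := by
    rw [hadef]
    field_simp
  have hale : a ≤ 1 := by nlinarith
  have hab : a + (1 - a) = 1 := by ring
  have hmem := hQ hy₀.1 hy ha.le (sub_nonneg.2 hale) hab
  have hpos := homogeneous_combo (LinearMap.snd ℝ U ℝ ∘ₗ T.toLinearMap) y₀ y hab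
  have hval := homogeneous_combo (f ∘ₗ T.toLinearMap) y₀ y hab
  simp only [LinearMap.comp_apply, LinearEquiv.coe_coe, LinearMap.snd_apply] at hpos hval
  have h1 := mul_pos ha (hT.pos hy₀)
  have h2 := mul_nonneg (sub_nonneg.2 hale) (hT.nonneg y hy)
  have h3 := key _ hmem (by rw [hpos]; linarith)
  rw [hval] at h3
  nlinarith

end Projective

/-! ### The correspondence between faces of `P` and faces of `Q` outside `F` -/

section VisitedFaces

variable {d e n : ℕ} {P : Set (EuclideanSpace ℝ (Fin d))}
  {F : Set (EuclideanSpace ℝ (Fin e))} {v : Fin n → EuclideanSpace ℝ (Fin e)}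
  {T : (EuclideanSpace ℝ (Fin e) × ℝ) ≃ₗ[ℝ] ((EuclideanSpace ℝ (Fin d) ⧸ linealitySpace P) × ℝ)}

/-- An affine function that is nonnegative on `P` factors through the quotient of the ambient space
by the lineality space of `P`. -/
theorem exists_homogeneous_quotient (hne : P.Nonempty)
    {h : (EuclideanSpace ℝ (Fin d) × ℝ) →ₗ[ℝ] ℝ} (h0 : ∀ x ∈ P, 0 ≤ h (x, 1)) :
    ∃ f : ((EuclideanSpace ℝ (Fin d) ⧸ linealitySpace P) × ℝ) →ₗ[ℝ] ℝ,
      ∀ x, f ((linealitySpace P).mkQ x, 1) = h (x, 1) := by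
  have hker : linealitySpace P ≤ LinearMap.ker (h ∘ₗ LinearMap.inl ℝ _ ℝ) := by
    intro w hw
    obtain ⟨x, hx⟩ := hne
    rw [LinearMap.mem_ker]
    change h (w, 0) = 0
    by_contra hw0
    -- The step along `w` is chosen so that `h` takes the value -1.
    have := h0 _ (hw x hx (-(h (x, 1) + 1) / h (w, 0)))
    have heq : ∀ t : ℝ, h (x + t • w, 1) = h (x, 1) + t * h (w, 0) := by
      intro t
      rw [← smul_eq_mul, ← map_smul, ← map_add]
      simp
    rw [heq, div_mul_cancel₀ _ hw0] at this
    linarith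
  refine ⟨(linealitySpace P).liftQ _ hker ∘ₗ LinearMap.fst ℝ _ ℝ +
    h (0, 1) • LinearMap.snd ℝ _ ℝ, fun x => ?_⟩
  rw [homogeneous_apply h x 1]
  simp

theorem visitedFace_eq
    (hT : IsProjectivelyEquivalent ((linealitySpace P).mkQ '' P) (convexHull ℝ (Set.range v)) F T)
    {S : Finset (Fin n)} {f : ((EuclideanSpace ℝ (Fin d) ⧸ linealitySpace P) × ℝ) →ₗ[ℝ] ℝ}
    (h0 : ∀ i, 0 ≤ f (T (v i, 1))) (hz : ∀ i, i ∈ S ↔ f (T (v i, 1)) = 0) :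
    visitedFace P F v T S = {x ∈ P | f ((linealitySpace P).mkQ x, 1) = 0} := by
  have hconv : ∀ y, y ∈ convexHull ℝ (v '' (S : Set (Fin n))) ↔
      y ∈ convexHull ℝ (Set.range v) ∧ f (T (y, 1)) = 0 := fun y =>
    mem_convexHull_image_iff (h := f ∘ₗ T.toLinearMap) h0 hz
  ext x
  refine and_congr_right fun hx => ?_
  constructor
  · rintro ⟨y, ⟨hyS, hyF⟩, hyx⟩
    obtain ⟨hyQ, hy0⟩ := (hconv y).1 hyS
    have hpos := (hT.pos ⟨hyQ, hyF⟩).ne'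
    rw [homogeneous_projMap T f hpos, hyx] at hy0
    exact (mul_eq_zero.1 hy0).resolve_left hpos
  · intro hfx
    have hmem : (linealitySpace P).mkQ x ∈ (linealitySpace P).mkQ '' P := ⟨x, hx, rfl⟩
    rw [← hT.image_eq] at hmem
    obtain ⟨y, hy, hyx⟩ := hmem
    refine ⟨y, ⟨(hconv y).2 ⟨hy.1, ?_⟩, hy.2⟩, hyx⟩
    rw [homogeneous_projMap T f (hT.pos hy).ne', hyx, hfx, mul_zero]

theorem exists_homogeneous_image
    (hT : IsProjectivelyEquivalent ((linealitySpace P).mkQ '' P) (convexHull ℝ (Set.range v)) F T)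
    {S : Finset (Fin n)} (hS : IsFaceSet v S) :
    ∃ f : ((EuclideanSpace ℝ (Fin d) ⧸ linealitySpace P) × ℝ) →ₗ[ℝ] ℝ,
      (∀ i, 0 ≤ f (T (v i, 1))) ∧ (∀ i, i ∈ S ↔ f (T (v i, 1)) = 0) ∧
        ∀ x ∈ P, 0 ≤ f ((linealitySpace P).mkQ x, 1) := by
  obtain ⟨h, h0, hz⟩ := hS
  refine ⟨h ∘ₗ T.symm.toLinearMap, by simpa using h0, by simpa using hz, fun x hx => ?_⟩
  have hmem : (linealitySpace P).mkQ x ∈ (linealitySpace P).mkQ '' P := ⟨x, hx, rfl⟩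
  rw [← hT.image_eq] at hmem
  obtain ⟨y, hy, hyx⟩ := hmem
  have h1 := homogeneous_projMap T (h ∘ₗ T.symm.toLinearMap) (hT.pos hy).ne'
  have h2 := nonneg_on_convexHull h0 hy.1
  rw [← hyx]
  refine nonneg_of_mul_nonneg_right ?_ (hT.pos hy)
  rw [← h1]
  simpa using h2

theorem exists_mem_diff_marked {S : Finset (Fin n)} (hSF : ¬ S ⊆ vertexSet v F) :
    ∃ i ∈ S, v i ∉ F := by
  obtain ⟨i, hi, hiF⟩ := Finset.not_subset.1 hSF
  exact ⟨i, hi, fun h => hiF (mem_vertexSet.2 h)⟩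

theorem isFaceOf_visitedFace
    (hT : IsProjectivelyEquivalent ((linealitySpace P).mkQ '' P) (convexHull ℝ (Set.range v)) F T)
    {S : Finset (Fin n)} (hS : IsFaceSet v S) (hSF : ¬ S ⊆ vertexSet v F) :
    IsFaceOf P (visitedFace P F v T S) ∧ (visitedFace P F v T S).Nonempty := by
  obtain ⟨f, h0, hz, hf⟩ := exists_homogeneous_image hT hS
  constructor
  · rw [visitedFace_eq hT h0 hz]
    exact isExposed_setOf_homogeneous_eq_zero
      (f ∘ₗ (linealitySpace P).mkQ.prodMap LinearMap.id) hf
  · obtain ⟨i, hi, hiF⟩ := exists_mem_diff_marked hSF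
    have hmem : projMap T (v i) ∈ (linealitySpace P).mkQ '' P := by
      rw [← hT.image_eq]
      exact ⟨v i, ⟨mem_range_convexHull v i, hiF⟩, rfl⟩
    obtain ⟨x, hx, hxi⟩ := hmem
    exact ⟨x, hx, v i, ⟨subset_convexHull ℝ _ ⟨i, hi, rfl⟩, hiF⟩, hxi.symm⟩

/-- Some `v j` with `j ∈ S` lies off `F`. For any `i ∈ S`, even with `v i ∈ F`, the midpoint of `v
j` and `v i` is off `F` too. The pulled-back function of `S'` vanishes at `v j` and at the midpoint,
hence at `v i`. -/
theorem subset_of_visitedFace_subset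
    (hT : IsProjectivelyEquivalent ((linealitySpace P).mkQ '' P) (convexHull ℝ (Set.range v)) F T)
    {S S' : Finset (Fin n)} (hSF : ¬ S ⊆ vertexSet v F) (hS' : IsFaceSet v S')
    (hsub : visitedFace P F v T S ⊆ visitedFace P F v T S') : S ⊆ S' := by
  obtain ⟨f, h0, hz, hf⟩ := exists_homogeneous_image hT hS'
  rw [visitedFace_eq hT h0 hz] at hsub
  have key : ∀ y ∈ convexHull ℝ (v '' (S : Set (Fin n))), 0 < (T (y, 1)).2 →
      f (T (y, 1)) = 0 := by
    intro y hy hpos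
    have hyF : y ∉ F := by
      rw [hT.marked_eq]
      exact fun h => hpos.ne' h.2
    have hyQ := convexHull_mono (Set.image_subset_range _ _) hy
    have hmem : projMap T y ∈ (linealitySpace P).mkQ '' P := by
      rw [← hT.image_eq]
      exact ⟨y, ⟨hyQ, hyF⟩, rfl⟩
    obtain ⟨x, hx, hxy⟩ := hmem
    have := (hsub ⟨hx, y, ⟨hy, hyF⟩, hxy.symm⟩).2
    rw [homogeneous_projMap T f hpos.ne', ← hxy, this, mul_zero]
  obtain ⟨j, hj, hjF⟩ := exists_mem_diff_marked hSF
  have hjS : v j ∈ convexHull ℝ (v '' (S : Set (Fin n))) := subset_convexHull ℝ _ ⟨j, hj, rfl⟩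
  have hjpos := hT.pos ⟨mem_range_convexHull v j, hjF⟩
  intro i hi
  have hiS : v i ∈ convexHull ℝ (v '' (S : Set (Fin n))) := subset_convexHull ℝ _ ⟨i, hi, rfl⟩
  have hi0 := hT.nonneg _ (mem_range_convexHull v i)
  have hab : (1 / 2 : ℝ) + 1 / 2 = 1 := by norm_num
  have hmid := convex_convexHull ℝ _ hjS hiS (by norm_num) (by norm_num) hab
  have hpos := homogeneous_combo (LinearMap.snd ℝ _ ℝ ∘ₗ T.toLinearMap) (v j) (v i) hab
  have hval := homogeneous_combo (f ∘ₗ T.toLinearMap) (v j) (v i) hab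
  simp only [LinearMap.comp_apply, LinearEquiv.coe_coe, LinearMap.snd_apply] at hpos hval
  rw [key _ hmid (by rw [hpos]; linarith), key _ hjS hjpos] at hval
  exact (hz i).2 (by linarith)

theorem exists_visitedFace_eq
    (hT : IsProjectivelyEquivalent ((linealitySpace P).mkQ '' P) (convexHull ℝ (Set.range v)) F T)
    {G : Set (EuclideanSpace ℝ (Fin d))} (hG : IsFaceOf P G) (hne : G.Nonempty) :
    ∃ S, IsFaceSet v S ∧ ¬ S ⊆ vertexSet v F ∧ visitedFace P F v T S = G := by
  obtain ⟨h, hP0, rfl⟩ := IsExposed.exists_homogeneous hG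
  obtain ⟨x, hx, hhx⟩ := hne
  obtain ⟨f, hf⟩ := exists_homogeneous_quotient ⟨x, hx⟩ hP0
  have hmem : (linealitySpace P).mkQ x ∈ (linealitySpace P).mkQ '' P := ⟨x, hx, rfl⟩
  rw [← hT.image_eq] at hmem
  obtain ⟨y, hy, hyx⟩ := hmem
  have hf0 : ∀ u ∈ (linealitySpace P).mkQ '' P, 0 ≤ f (u, 1) := by
    rintro _ ⟨x, hx, rfl⟩
    rw [hf]
    exact hP0 x hx
  have h0 : ∀ i, 0 ≤ f (T (v i, 1)) := fun i =>
    hT.nonneg_comp (convex_convexHull ℝ _) ⟨y, hy⟩ hf0 (mem_range_convexHull v i)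
  classical
  let S : Finset (Fin n) := Finset.univ.filter fun i => f (T (v i, 1)) = 0
  have hz : ∀ i, i ∈ S ↔ f (T (v i, 1)) = 0 := fun i => by simp [S]
  have hvis : visitedFace P F v T S = {x ∈ P | h (x, 1) = 0} := by
    rw [visitedFace_eq hT h0 hz]
    simp only [hf]
  -- If `S` consisted of vertices of `F`, its hull would lie at infinity, although `x` comes from a
  -- point `w` of that hull outside `F`.
  refine ⟨S, ⟨f ∘ₗ T.toLinearMap, h0, hz⟩, fun hSF => ?_, hvis⟩
  have hxS : x ∈ visitedFace P F v T S := hvis ▸ ⟨hx, hhx⟩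
  obtain ⟨-, w, ⟨hwS, hwF⟩, -⟩ := hxS
  have hwQ := convexHull_mono (Set.image_subset_range _ _) hwS
  refine hwF ?_
  rw [hT.marked_eq]
  refine ⟨hwQ, ((mem_convexHull_image_iff (h := LinearMap.snd ℝ _ ℝ ∘ₗ T.toLinearMap)
    (S := vertexSet v F) (fun i => hT.nonneg _ (mem_range_convexHull v i)) fun i => ?_).1
      (convexHull_mono (Set.image_mono (Finset.coe_subset.2 hSF)) hwS)).2⟩
  rw [mem_vertexSet, hT.marked_eq]
  exact and_iff_right (mem_range_convexHull v i)

theorem nodup_and_mem_visitedSets_iff {Q : Set (EuclideanSpace ℝ (Fin e))}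
    {facets : List (Finset (Fin n))} (hinc : IsVertexFacetIncidences Q v facets)
    (hQ : Q = convexHull ℝ (Set.range v)) {M : Finset (Fin n)} (hM : ¬ Finset.univ ⊆ M)
    (arrange : (l : List (Finset (Fin n))) → {l' : List (Finset (Fin n)) // l'.Perm l}) :
    (visitedSets arrange facets M).Nodup ∧
      ∀ S, S ∈ visitedSets arrange facets M ↔ IsFaceSet v S ∧ ¬ S ⊆ M := by
  obtain ⟨h1, h2⟩ := faceIterator_nodup_and_mem_iff (𝓕 := IsFaceSet v)
    (fun _ _ ha hb => ha.inter hb) (isLocallyBranched_isFaceSet v) arrange Finset.univ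
    (facets.filter (fun x => ¬ x ⊆ M)) [M] (isFaceSet_univ v) (hinc.nodup.filter _)
    (fun b => by simp [hinc.mem_iff_isCoatomBelow hQ])
  simp only [List.mem_singleton, forall_eq] at h2
  rw [visitedSets]
  refine ⟨List.nodup_cons.2 ⟨fun h => ((h2 _).1 h).2.1.ne rfl, h1⟩, fun S => ?_⟩
  rw [List.mem_cons, h2]
  constructor
  · rintro (rfl | ⟨hS, -, hSM⟩)
    · exact ⟨isFaceSet_univ v, hM⟩
    · exact ⟨hS, hSM⟩
  · rintro ⟨hS, hSM⟩
    exact (eq_or_ne S Finset.univ).imp_right fun h => ⟨hS, Finset.ssubset_univ_iff.2 h, hSM⟩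

end VisitedFaces

theorem corollary3p5 {d e n : ℕ}
    (P : Set (EuclideanSpace ℝ (Fin d)))
    (hP : IsPolyhedron P) (hPunb : ¬ Bornology.IsBounded P)
    (Q F : Set (EuclideanSpace ℝ (Fin e))) (hQ : IsPolytope Q)
    (T : (EuclideanSpace ℝ (Fin e) × ℝ) ≃ₗ[ℝ]
      ((EuclideanSpace ℝ (Fin d) ⧸ linealitySpace P) × ℝ))
    (hT : IsProjectivelyEquivalent ((linealitySpace P).mkQ '' P) Q F T)
    (v : Fin n → EuclideanSpace ℝ (Fin e)) (facets : List (Finset (Fin n)))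
    (hinc : IsVertexFacetIncidences Q v facets)
    (arrange : (l : List (Finset (Fin n))) → {l' : List (Finset (Fin n)) // l'.Perm l}) :
    ((visitedSets arrange facets (vertexSet v F)).map (visitedFace P F v T)).Nodup ∧
    ∀ G : Set (EuclideanSpace ℝ (Fin d)),
      G ∈ (visitedSets arrange facets (vertexSet v F)).map (visitedFace P F v T) ↔
        IsFaceOf P G ∧ G.Nonempty := by
  have hQv : Q = convexHull ℝ (Set.range v) := hQ.eq_convexHull_range hinc.range_eq
  have hPne : P.Nonempty := by
    rw [Set.nonempty_iff_ne_empty]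
    rintro rfl
    exact hPunb Bornology.isBounded_empty
  have hT' := hT
  rw [hQv] at hT'
  -- Applied to the face `P` itself, this shows that not all vertices lie in `F`, so visiting the
  -- full set is legitimate.
  obtain ⟨S₀, -, hS₀, -⟩ := exists_visitedFace_eq hT' (IsExposed.refl (𝕜 := ℝ) P) hPne
  obtain ⟨hnd, hmem⟩ := nodup_and_mem_visitedSets_iff hinc hQv (M := vertexSet v F)
    (fun h => hS₀ ((Finset.subset_univ S₀).trans h)) arrange
  refine ⟨hnd.map_on fun S hS S' hS' heq => ?_, fun G => ?_⟩
  · rw [hmem] at hS hS'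
    exact (subset_of_visitedFace_subset hT' hS.2 hS'.1 heq.le).antisymm
      (subset_of_visitedFace_subset hT' hS'.2 hS.1 heq.ge)
  · rw [List.mem_map]
    constructor
    · rintro ⟨S, hS, rfl⟩
      rw [hmem] at hS
      exact isFaceOf_visitedFace hT' hS.1 hS.2
    · rintro ⟨hG, hne⟩
      obtain ⟨S, hS, hSF, rfl⟩ := exists_visitedFace_eq hT' hG hne
      exact ⟨S, (hmem S).2 ⟨hS, hSF⟩, rfl⟩
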